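/- For $M\in\mathbb{N}$ and $\sigma^2>0$ let $\mathrm{E}$ be a random real $M\times M$ matrix whose entries are independent centered Gaussian variables with variance $\sigma^2$; for $C\in\mathbb{R}^{M\times M}$ put $X=C+\mathrm{E}$. Let $\|\cdot\|_{S_2}$ be the Hilbert-Schmidt (Frobenius) norm, let $\mathcal{S}_{M,1}$ be the set of all $M\times M$ matrices of orthogonal projections onto one-dimensional subspaces of $\mathbb{R}^M$, let $\hat\pi_1$ be a maximizer of $\tilde\pi\mapsto\|\tilde\pi X\|_{S_2}^2$ over $\mathcal{S}_{M,1}$ and $\pi_1$ a maximizer of $\tilde\pi\mapsto\mathbf{E}\|\tilde\pi X\|_{S_2}^2$ over $\mathcal{S}_{M,1}$, and define $$\delta_{C,M,\sigma^2,1}:=\mathbf{E}\|\hat\pi_1X\|_{S_2}^2-\mathbf{E}\|\pi_1X\|_{S_2}^2 .$$ Then there exist an absolute constant $c>0$ and an $M_0\in\mathbb{N}$, neither depending on $\sigma^2$, such that for all $M\ge M_0$ and all $\sigma^2>0$ the expectations in this definition are finite for every $C$, and $$\inf_{C\in\mathbb{R}^{M\times M}}\delta_{C,M,\sigma^2,1}\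 \ge\ c\,\delta_{0,M,\sigma^2,1}\qquad\text{and}\qquad \inf_{C\in\mathbb{R}^{M\times M}}\delta_{C,M,\sigma^2,1}\ \ge\ c\,\sigma^2M .$$ Consequently, for the largest singular values $\hat\lambda_1$ of $X$ and $\lambda_1$ of $C$, one has $\mathbf{E}\hat\lambda_1^2-\sigma^2M-\lambda_1^2\ge c\,\sigma^2M$ for every $C\in\mathbb{R}^{M\times M}$. -/

import Mathlib

open MeasureTheory ProbabilityTheory
open scoped NNReal

noncomputable section

namespace RankProjection

/-- The squared Hilbert-Schmidt (Frobenius) norm of a real matrix. -/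
def hsNormSq {M : ℕ} (A : Matrix (Fin M) (Fin M) ℝ) : ℝ :=
  ∑ i, ∑ j, A i j ^ 2

/-- The set of all `M × M` matrices representing orthogonal projections onto `r`-dimensional
linear subspaces of `ℝ^M`. -/
def orthProj (M r : ℕ) : Set (Matrix (Fin M) (Fin M) ℝ) :=
  {P | IsStarProjection P ∧ P.rank = r}

open Classical in
/-- A maximizer of `f` over the rank-`r` orthogonal projections (some choice of it). It exists for
continuous `f` and `r ≤ M`, see `argmaxProj_spec`; the value `0` is used if there is none. -/
def argmaxProj {M : ℕ} (r : ℕ) (f : Matrix (Fin M) (Fin M) ℝ → ℝ) : Matrix (Fin M) (Fin M) ℝ :=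
  if h : ∃ P ∈ orthProj M r, IsMaxOn f (orthProj M r) P then h.choose else 0

/-- The empirical projection: a maximizer of `P ↦ ‖P X‖²` for a given matrix `X`. -/
def empiricalProj {M : ℕ} (r : ℕ) (X : Matrix (Fin M) (Fin M) ℝ) : Matrix (Fin M) (Fin M) ℝ :=
  argmaxProj r fun P => hsNormSq (P * X)

/-- The population projection: a maximizer of `P ↦ 𝐄 ‖P X‖²` for a given random matrix `X`. -/
def populationProj {M : ℕ} {Ω : Type*} [MeasurableSpace Ω] (μ : Measure Ω) (r : ℕ)
    (X : Ω → Matrix (Fin M) (Fin M) ℝ) : Matrix (Fin M) (Fin M) ℝ :=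
  argmaxProj r fun P => ∫ ω, hsNormSq (P * X ω) ∂μ

/-- The accuracy of approximation `𝐄 ‖π̂_r X‖² - 𝐄 ‖π_r X‖²` in the model `X = C + E`. -/
def delta {M : ℕ} {Ω : Type*} [MeasurableSpace Ω] (μ : Measure Ω)
    (E : Ω → Matrix (Fin M) (Fin M) ℝ) (C : Matrix (Fin M) (Fin M) ℝ) (r : ℕ) : ℝ :=
  ∫ ω, hsNormSq (empiricalProj r (C + E ω) * (C + E ω)) ∂μ
    - ∫ ω, hsNormSq (populationProj μ r (fun ω' => C + E ω') * (C + E ω)) ∂μ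

/-- `E` is a random matrix whose entries are independent centered Gaussians of variance `v`. -/
structure IsGaussianMatrix {M : ℕ} {Ω : Type*} [MeasurableSpace Ω] (μ : Measure Ω) (v : ℝ≥0)
    (E : Ω → Matrix (Fin M) (Fin M) ℝ) : Prop where
  hasLaw : ∀ i j, HasLaw (fun ω => E ω i j) (gaussianReal 0 v) μ
  indep : iIndepFun (fun (p : Fin M × Fin M) ω => E ω p.1 p.2) μ

/-- The largest singular value of a square matrix. -/
def topSingularValue {M : ℕ} (A : Matrix (Fin M) (Fin M) ℝ) : ℝ :=
  (Matrix.toEuclideanLin A).singularValues 0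

theorem rank_eq_trace {M : ℕ} {P : Matrix (Fin M) (Fin M) ℝ} (hP : P * P = P) :
    (P.rank : ℝ) = P.trace := by
  have hid : IsIdempotentElem (Matrix.toLin' P) := by
    change Matrix.toLin' P * Matrix.toLin' P = Matrix.toLin' P
    rw [Module.End.mul_eq_comp, ← Matrix.toLin'_mul, hP]
  have h := (LinearMap.IsIdempotentElem.isProj_range _ hid).trace
  rw [Matrix.trace_toLin'_eq] at h
  rw [h]
  rfl

theorem isCompact_orthProj (M r : ℕ) : IsCompact (orthProj M r) := by
  have heq : orthProj M r
      = {P | P * P = P} ∩ {P | P.transpose = P} ∩ {P | P.trace = (r : ℝ)} := by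
    ext P
    simp only [orthProj, Set.mem_ofPred_eq, Set.mem_inter_iff]
    constructor
    · rintro ⟨⟨h1, h2⟩, h3⟩
      refine ⟨⟨h1, ?_⟩, ?_⟩
      · have h2' : P.conjTranspose = P := h2
        simpa using h2'
      · rw [← rank_eq_trace h1, h3]
    · rintro ⟨⟨h1, h2⟩, h3⟩
      refine ⟨⟨h1, ?_⟩, ?_⟩
      · change P.conjTranspose = P
        simpa using h2
      · rw [← rank_eq_trace h1] at h3
        exact_mod_cast h3
  have hclosed : IsClosed (orthProj M r) := by
    rw [heq]
    refine ((isClosed_eq (by fun_prop) (by fun_prop)).inter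
      (isClosed_eq (by fun_prop) (by fun_prop))).inter (isClosed_eq (by fun_prop) (by fun_prop))
  have hbox : IsCompact (Set.univ.pi fun _ : Fin M => Set.univ.pi fun _ : Fin M =>
      Set.Icc (-1 : ℝ) 1) :=
    isCompact_univ_pi fun _ => isCompact_univ_pi fun _ => isCompact_Icc
  refine hbox.of_isClosed_subset hclosed ?_
  intro (P : Matrix (Fin M) (Fin M) ℝ) hP
  rw [heq] at hP
  obtain ⟨⟨h1, h2⟩, -⟩ := hP
  change P * P = P at h1
  change P.transpose = P at h2
  have hsym : ∀ i j, P i j = P j i := fun i j => congrFun (congrFun h2.symm i) j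
  have hdiag : ∀ i, P i i = ∑ k, P i k ^ 2 := by
    intro i
    have h := congrFun (congrFun h1 i) i
    rw [Matrix.mul_apply] at h
    rw [← h]
    exact Finset.sum_congr rfl fun k _ => by rw [hsym k i, sq]
  have hle : ∀ i j, P i j ^ 2 ≤ P i i := by
    intro i j
    rw [hdiag i]
    exact Finset.single_le_sum (f := fun k => P i k ^ 2) (fun k _ => sq_nonneg _)
      (Finset.mem_univ j)
  intro i _ j _
  have h3 := hle i i
  have h4 := hle i j
  have h5 : P i i ≤ 1 := by nlinarith
  exact abs_le.mp ((sq_le_one_iff_abs_le_one (P i j)).mp (h4.trans h5))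

theorem orthProj_nonempty {M r : ℕ} (h : r ≤ M) : (orthProj M r).Nonempty := by
  refine ⟨Matrix.diagonal fun i : Fin M => if (i : ℕ) < r then 1 else 0, ⟨?_, ?_⟩, ?_⟩
  · change _ * _ = _
    rw [Matrix.diagonal_mul_diagonal]
    congr 1
    funext i
    split_ifs <;> simp
  · change Matrix.conjTranspose _ = _
    rw [Matrix.diagonal_conjTranspose]
    simp
  · have hidem : (Matrix.diagonal fun i : Fin M => if (i : ℕ) < r then (1 : ℝ) else 0) *
        (Matrix.diagonal fun i : Fin M => if (i : ℕ) < r then (1 : ℝ) else 0) =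
        Matrix.diagonal fun i : Fin M => if (i : ℕ) < r then (1 : ℝ) else 0 := by
      rw [Matrix.diagonal_mul_diagonal]
      congr 1
      funext i
      split_ifs <;> simp
    have h1 := rank_eq_trace hidem
    rw [Matrix.trace_diagonal, Fin.sum_univ_eq_sum_range (fun i => if i < r then (1 : ℝ) else 0),
      Finset.sum_ite, Finset.sum_const_zero, add_zero, Finset.sum_const, nsmul_eq_mul, mul_one] at h1
    have h2 : (Finset.range M).filter (fun i => i < r) = Finset.range r := by
      ext i
      simp only [Finset.mem_filter, Finset.mem_range]
      omega
    rw [h2, Finset.card_range] at h1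
    exact_mod_cast h1

/-- The maximizer exists, so that `argmaxProj` has its intended meaning. -/
theorem argmaxProj_spec {M r : ℕ} (h : r ≤ M) {f : Matrix (Fin M) (Fin M) ℝ → ℝ}
    (hf : ContinuousOn f (orthProj M r)) :
    argmaxProj r f ∈ orthProj M r ∧ IsMaxOn f (orthProj M r) (argmaxProj r f) := by
  have hex := (isCompact_orthProj M r).exists_isMaxOn (orthProj_nonempty h) hf
  rw [argmaxProj, dif_pos hex]
  exact hex.choose_spec

end RankProjection

end

/-!
For rank-one projections `P`, the maximum of `‖P X‖_{S₂}²` is `‖X‖²`, the squared operator norm, and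
`𝐄 ‖P X‖_{S₂}² = ‖P C‖_{S₂}² + v M`. Hence `δ_C = 𝐄 ‖X‖² - v M - ‖C‖²`.

Lower bound: by rotation invariance of the noise a top left singular vector of `C` may be taken to
be a coordinate vector, so that the corresponding row of `C` has norm `‖C‖`. Testing `X` on the
normalisation `w` of its own row `k` gives `‖X‖² ≥ |X_k|² + ∑_{i ≠ k} ⟨X_i, w⟩²`. The first term has
mean `‖C‖² + v M`, and each of the other `M - 1` has mean at least `v`, because `X_i` is independent
of `w`. Hence `δ_C ≥ v (M - 1)`.

Upper bound for `C = 0`: around a norming unit vector there is a ball of radius `1/2` on which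
`|E z| ≥ ‖E‖ / 2`. Averaging `𝐄 exp (t |E z|²)` over the ball of radius `3/2` therefore costs only
the volume ratio `3 ^ M`, and Jensen's inequality turns the resulting exponential moment into
`𝐄 ‖E‖² ≤ 48 v M`.
-/

namespace RankProjection

open Matrix
open scoped Matrix.Norms.L2Operator

section OperatorNorm

theorem exists_norm_eq_one_norm_apply_eq {E F : Type*} [NormedAddCommGroup E] [NormedSpace ℝ E]
    [FiniteDimensional ℝ E] [Nontrivial E] [SeminormedAddCommGroup F] [NormedSpace ℝ F]
    (T : E →L[ℝ] F) : ∃ x, ‖x‖ = 1 ∧ ‖T x‖ = ‖T‖ := by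
  have : ProperSpace E := FiniteDimensional.proper_real E
  obtain ⟨x, hx, hmax⟩ := (isCompact_sphere (0 : E) 1).exists_isMaxOn
    (NormedSpace.sphere_nonempty.2 zero_le_one) (T.continuous.norm.continuousOn)
  rw [mem_sphere_zero_iff_norm] at hx
  refine ⟨x, hx, le_antisymm (by simpa [hx] using T.le_opNorm x) ?_⟩
  refine T.opNorm_le_of_unit_norm (norm_nonneg _) fun y hy => hmax (by simpa using hy)

variable {𝕜 E F : Type*} [RCLike 𝕜] [NormedAddCommGroup E] [InnerProductSpace 𝕜 E]
  [FiniteDimensional 𝕜 E] [NormedAddCommGroup F] [InnerProductSpace 𝕜 F] [FiniteDimensional 𝕜 F]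

theorem inner_adjoint_comp_self_apply (T : E →ₗ[𝕜] F) (x : E) :
    inner 𝕜 x ((T.adjoint ∘ₗ T) x) = (‖T x‖ : 𝕜) ^ 2 := by
  rw [LinearMap.comp_apply, LinearMap.adjoint_inner_right, inner_self_eq_norm_sq_to_K]

theorem norm_sq_apply_eq_sum_singularValues_sq (T : E →ₗ[𝕜] F) (x : E) :
    ‖T x‖ ^ 2 = ∑ i : Fin (Module.finrank 𝕜 E), T.singularValues i ^ 2 *
      ‖inner 𝕜 (T.isSymmetric_adjoint_comp_self.eigenvectorBasis rfl i) x‖ ^ 2 := by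
  have hT := T.isSymmetric_adjoint_comp_self
  set b := hT.eigenvectorBasis rfl with hb
  apply RCLike.ofReal_injective (K := 𝕜)
  push_cast
  rw [← inner_adjoint_comp_self_apply, ← b.sum_inner_mul_inner x]
  refine Finset.sum_congr rfl fun i _ => ?_
  rw [← hT, hb, hT.apply_eigenvectorBasis, inner_smul_left, ← T.sq_singularValues_fin rfl i,
    mul_left_comm, ← RCLike.conj_mul, inner_conj_symm, RCLike.conj_ofReal, RCLike.ofReal_pow]

theorem exists_norm_apply_eq_singularValues_zero_mul [Nontrivial E] (T : E →ₗ[𝕜] F) :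
    ∃ x ≠ 0, ‖T x‖ = T.singularValues 0 * ‖x‖ := by
  obtain ⟨x, hx⟩ := (T.hasEigenvalue_adjoint_comp_self_sq_singularValues
    (Module.finrank_pos (R := 𝕜) (M := E))).exists_hasEigenvector
  have h := inner_adjoint_comp_self_apply T x
  rw [hx.apply_eq_smul, inner_smul_right, inner_self_eq_norm_sq_to_K] at h
  norm_cast at h
  rw [← mul_pow, sq_eq_sq₀ (mul_nonneg (T.singularValues_nonneg 0) (norm_nonneg x))
    (norm_nonneg _)] at h
  exact ⟨x, hx.2, h.symm⟩

theorem singularValues_zero_eq_norm (T : E →L[𝕜] F) : (T : E →ₗ[𝕜] F).singularValues 0 = ‖T‖ := by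
  set S : E →ₗ[𝕜] F := T.toLinearMap
  apply le_antisymm
  · rcases subsingleton_or_nontrivial E with hE | hE
    · rw [S.singularValues_of_finrank_le (Module.finrank_zero_of_subsingleton.trans_le zero_le)]
      exact norm_nonneg T
    · obtain ⟨x, hx, hSx⟩ := exists_norm_apply_eq_singularValues_zero_mul S
      exact le_of_mul_le_mul_right (hSx.symm.trans_le (T.le_opNorm x)) (norm_pos_iff.2 hx)
  · refine T.opNorm_le_bound (S.singularValues_nonneg 0) fun x => ?_
    refine le_of_sq_le_sq ?_ (mul_nonneg (S.singularValues_nonneg 0) (norm_nonneg x))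
    calc
      ‖S x‖ ^ 2 ≤ ∑ i : Fin (Module.finrank 𝕜 E), S.singularValues 0 ^ 2 *
          ‖inner 𝕜 (S.isSymmetric_adjoint_comp_self.eigenvectorBasis rfl i) x‖ ^ 2 := by
        rw [norm_sq_apply_eq_sum_singularValues_sq]
        gcongr with i
        · exact S.singularValues_nonneg _
        · exact S.singularValues_antitone (Nat.zero_le _)
      _ = (S.singularValues 0 * ‖x‖) ^ 2 := by
        rw [← Finset.mul_sum, OrthonormalBasis.sum_sq_norm_inner_right, mul_pow]

end OperatorNorm

section Matrix

theorem norm_toLp_sq {ι : Type*} [Fintype ι] (x : ι → ℝ) : ‖WithLp.toLp 2 x‖ ^ 2 = x ⬝ᵥ x := by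
  rw [EuclideanSpace.real_norm_sq_eq, dotProduct]
  exact Finset.sum_congr rfl fun i _ => sq _

variable {m n : Type*} [Fintype m] [Fintype n] [DecidableEq n]

theorem topSingularValue_eq_norm {M : ℕ} (A : Matrix (Fin M) (Fin M) ℝ) :
    topSingularValue A = ‖A‖ :=
  singularValues_zero_eq_norm (toEuclideanCLM (𝕜 := ℝ) A)

theorem mulVec_dotProduct_self_le (A : Matrix m n ℝ) (x : n → ℝ) :
    (A *ᵥ x) ⬝ᵥ (A *ᵥ x) ≤ ‖A‖ ^ 2 * (x ⬝ᵥ x) := by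
  rw [← norm_toLp_sq, ← norm_toLp_sq, ← mul_pow]
  exact pow_le_pow_left₀ (norm_nonneg _) (l2_opNorm_mulVec A (WithLp.toLp 2 x)) 2

theorem norm_transpose [DecidableEq m] (A : Matrix m n ℝ) : ‖Aᵀ‖ = ‖A‖ := by
  rw [← conjTranspose_eq_transpose_of_trivial, l2_opNorm_conjTranspose]

theorem vecMul_dotProduct_self_le (A : Matrix m n ℝ) (x : m → ℝ) :
    (x ᵥ* A) ⬝ᵥ (x ᵥ* A) ≤ ‖A‖ ^ 2 * (x ⬝ᵥ x) := by
  classical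
  rw [← mulVec_transpose, ← norm_transpose]
  exact mulVec_dotProduct_self_le Aᵀ x

theorem exists_mulVec_dotProduct_self_eq [Nonempty n] (A : Matrix m n ℝ) :
    ∃ u, u ⬝ᵥ u = 1 ∧ (A *ᵥ u) ⬝ᵥ (A *ᵥ u) = ‖A‖ ^ 2 := by
  obtain ⟨u, hu, hAu⟩ := exists_norm_eq_one_norm_apply_eq
    (LinearMap.toContinuousLinearMap (toEuclideanLin (𝕜 := ℝ) A))
  refine ⟨u.ofLp, ?_, ?_⟩
  · rw [← norm_toLp_sq, WithLp.toLp_ofLp, hu, one_pow]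
  · rw [← norm_toLp_sq, l2_opNorm_def]
    exact congrArg (· ^ 2) hAu

theorem exists_vecMul_dotProduct_self_eq [Nonempty m] (A : Matrix m n ℝ) :
    ∃ u, u ⬝ᵥ u = 1 ∧ (u ᵥ* A) ⬝ᵥ (u ᵥ* A) = ‖A‖ ^ 2 := by
  classical
  simpa only [mulVec_transpose, norm_transpose] using exists_mulVec_dotProduct_self_eq Aᵀ

/-- The unit vector in the direction of `x`, the test vector for bounding an operator norm from
below by the row `x` of the matrix; it is `0` for `x = 0`. -/
noncomputable def direction {ι : Type*} [Fintype ι] (x : ι → ℝ) : ι → ℝ :=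
  ‖WithLp.toLp 2 x‖⁻¹ • x

theorem direction_dotProduct_self_of_ne_zero {ι : Type*} [Fintype ι] {x : ι → ℝ} (hx : x ≠ 0) :
    direction x ⬝ᵥ direction x = 1 := by
  have hx' : ‖WithLp.toLp 2 x‖ ≠ 0 := norm_ne_zero_iff.2 ((WithLp.toLp_eq_zero 2).not.2 hx)
  rw [direction, smul_dotProduct, dotProduct_smul, ← norm_toLp_sq, smul_eq_mul, smul_eq_mul]
  field_simp

theorem direction_dotProduct_self_le_one {ι : Type*} [Fintype ι] (x : ι → ℝ) :
    direction x ⬝ᵥ direction x ≤ 1 := by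
  rcases eq_or_ne x 0 with rfl | hx
  · simp [direction]
  · exact (direction_dotProduct_self_of_ne_zero hx).le

theorem abs_direction_apply_le_one {ι : Type*} [Fintype ι] (x : ι → ℝ) (i : ι) :
    |direction x i| ≤ 1 := by
  rw [← sq_le_one_iff_abs_le_one, sq]
  exact (Finset.single_le_sum (fun j _ => mul_self_nonneg (direction x j))
    (Finset.mem_univ i)).trans (direction_dotProduct_self_le_one x)

theorem measurable_direction {ι : Type*} [Fintype ι] :
    Measurable (direction : (ι → ℝ) → ι → ℝ) := by
  unfold direction
  fun_prop

theorem dotProduct_direction_sq {ι : Type*} [Fintype ι] (x : ι → ℝ) :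
    (x ⬝ᵥ direction x) ^ 2 = x ⬝ᵥ x := by
  rcases eq_or_ne x 0 with rfl | hx
  · simp
  · have hx' : ‖WithLp.toLp 2 x‖ ≠ 0 := norm_ne_zero_iff.2 ((WithLp.toLp_eq_zero 2).not.2 hx)
    rw [direction, dotProduct_smul, ← norm_toLp_sq, smul_eq_mul]
    field_simp

theorem dotProduct_self_add_sum_sq_dotProduct_direction_le [DecidableEq m] (A : Matrix m n ℝ)
    (k : m) :
    A k ⬝ᵥ A k + ∑ i ∈ Finset.univ.erase k, (A i ⬝ᵥ direction (A k)) ^ 2 ≤ ‖A‖ ^ 2 := by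
  calc
    _ = ∑ i, (A i ⬝ᵥ direction (A k)) ^ 2 := by
      rw [← Finset.add_sum_erase _ _ (Finset.mem_univ k), dotProduct_direction_sq]
    _ = (A *ᵥ direction (A k)) ⬝ᵥ (A *ᵥ direction (A k)) :=
      Finset.sum_congr rfl fun i _ => sq _
    _ ≤ ‖A‖ ^ 2 * (direction (A k) ⬝ᵥ direction (A k)) := mulVec_dotProduct_self_le A _
    _ ≤ ‖A‖ ^ 2 := mul_le_of_le_one_right (sq_nonneg _) (direction_dotProduct_self_le_one _)

theorem exists_mem_orthogonalGroup_row_eq (k : n) {u : n → ℝ} (hu : u ⬝ᵥ u = 1) :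
    ∃ U ∈ orthogonalGroup n ℝ, U k = u := by
  have hu' : ‖WithLp.toLp 2 u‖ = 1 := by
    rw [← sq_eq_sq₀ (norm_nonneg _) zero_le_one, norm_toLp_sq, hu, one_pow]
  have horth : Orthonormal ℝ (({k} : Set n).domRestrict fun _ => WithLp.toLp 2 u) :=
    ⟨fun _ => hu', fun i j hij => (hij (Subsingleton.elim i j)).elim⟩
  obtain ⟨b, hb⟩ := horth.exists_orthonormalBasis_extension_of_card_eq (by simp)
  refine ⟨of fun i => (b i).ofLp, (mem_orthogonalGroup_iff n ℝ).2 ?_,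
    congrArg WithLp.ofLp (hb k rfl)⟩
  ext i j
  refine (orthonormal_iff_ite.1 b.orthonormal j i).trans ?_
  simp only [one_apply, eq_comm]

end Matrix

section RankOneProjection

variable {M : ℕ}

theorem hsNormSq_eq_sum_dotProduct_self (A : Matrix (Fin M) (Fin M) ℝ) :
    hsNormSq A = ∑ i, A i ⬝ᵥ A i :=
  Finset.sum_congr rfl fun _ _ => Finset.sum_congr rfl fun _ _ => sq _

theorem hsNormSq_mul_le (P X : Matrix (Fin M) (Fin M) ℝ) :
    hsNormSq (P * X) ≤ ‖X‖ ^ 2 * hsNormSq P := by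
  simp only [hsNormSq_eq_sum_dotProduct_self, Finset.mul_sum, mul_apply_eq_vecMul]
  exact Finset.sum_le_sum fun i _ => vecMul_dotProduct_self_le X (P i)

theorem norm_sq_le_hsNormSq [NeZero M] (A : Matrix (Fin M) (Fin M) ℝ) : ‖A‖ ^ 2 ≤ hsNormSq A := by
  obtain ⟨u, hu, hAu⟩ := exists_mulVec_dotProduct_self_eq A
  rw [← hAu, hsNormSq_eq_sum_dotProduct_self]
  refine Finset.sum_le_sum fun i _ => ?_
  have cauchy_schwarz : (A i ⬝ᵥ u) ^ 2 ≤ (A i ⬝ᵥ A i) * (u ⬝ᵥ u) := by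
    simpa only [dotProduct, sq] using Finset.sum_mul_sq_le_sq_mul_sq Finset.univ (A i) u
  rwa [hu, mul_one, sq] at cauchy_schwarz

theorem hsNormSq_of_mem_orthProj {r : ℕ} {P : Matrix (Fin M) (Fin M) ℝ} (hP : P ∈ orthProj M r) :
    hsNormSq P = r := by
  obtain ⟨hstar, hrank⟩ := hP
  have hP : P * Pᵀ = P := by
    rw [← conjTranspose_eq_transpose_of_trivial, ← star_eq_conjTranspose,
      hstar.isSelfAdjoint.star_eq, hstar.isIdempotentElem.eq]
  rw [← hrank, rank_eq_trace hstar.isIdempotentElem.eq, hsNormSq_eq_sum_dotProduct_self]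
  conv_rhs => rw [← hP]
  rfl

theorem vecMulVec_self_mem_orthProj {u : Fin M → ℝ} (hu : u ⬝ᵥ u = 1) :
    vecMulVec u u ∈ orthProj M 1 := by
  have idem : vecMulVec u u * vecMulVec u u = vecMulVec u u := by
    rw [vecMulVec_mul_vecMulVec, hu, one_smul]
  refine ⟨⟨idem, ?_⟩, ?_⟩
  · rw [isSelfAdjoint_iff, star_eq_conjTranspose, conjTranspose_vecMulVec, star_trivial]
  · have htrace := rank_eq_trace idem
    rw [trace_vecMulVec, hu] at htrace
    exact_mod_cast htrace

theorem hsNormSq_vecMulVec (u w : Fin M → ℝ) :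
    hsNormSq (vecMulVec u w) = (u ⬝ᵥ u) * (w ⬝ᵥ w) := by
  simp only [hsNormSq, vecMulVec_apply, dotProduct, Finset.sum_mul_sum]
  exact Finset.sum_congr rfl fun i _ => Finset.sum_congr rfl fun j _ => by ring

theorem exists_mem_orthProj_hsNormSq_mul_eq [NeZero M] (X : Matrix (Fin M) (Fin M) ℝ) :
    ∃ P ∈ orthProj M 1, hsNormSq (P * X) = ‖X‖ ^ 2 := by
  obtain ⟨u, hu, hXu⟩ := exists_vecMul_dotProduct_self_eq X
  refine ⟨vecMulVec u u, vecMulVec_self_mem_orthProj hu, ?_⟩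
  rw [vecMulVec_mul, hsNormSq_vecMulVec, hu, one_mul, hXu]

theorem hsNormSq_mul_eq_of_isMaxOn [NeZero M] {X Q : Matrix (Fin M) (Fin M) ℝ}
    (hQ : Q ∈ orthProj M 1) (hmax : IsMaxOn (fun P => hsNormSq (P * X)) (orthProj M 1) Q) :
    hsNormSq (Q * X) = ‖X‖ ^ 2 := by
  obtain ⟨P, hP, hPX⟩ := exists_mem_orthProj_hsNormSq_mul_eq X
  refine le_antisymm ?_ (hPX.symm.trans_le (hmax hP))
  simpa only [hsNormSq_of_mem_orthProj hQ, Nat.cast_one, mul_one] using hsNormSq_mul_le Q X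

theorem continuous_hsNormSq_mul (X : Matrix (Fin M) (Fin M) ℝ) :
    Continuous fun P : Matrix (Fin M) (Fin M) ℝ => hsNormSq (P * X) := by
  unfold hsNormSq
  fun_prop

theorem hsNormSq_empiricalProj_mul [NeZero M] (X : Matrix (Fin M) (Fin M) ℝ) :
    hsNormSq (empiricalProj 1 X * X) = ‖X‖ ^ 2 := by
  obtain ⟨hmem, hmax⟩ := argmaxProj_spec (NeZero.one_le (n := M))
    (continuous_hsNormSq_mul X).continuousOn
  exact hsNormSq_mul_eq_of_isMaxOn hmem hmax

end RankOneProjection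

section SecondMoment

variable {ι Ω : Type*} [MeasurableSpace Ω] {μ : Measure Ω} {X Z : Ω → ι → ℝ}

theorem indepFun_mul_eval (hXZ : IndepFun X Z μ) (i j : ι) :
    IndepFun (fun ω => X ω i * X ω j) (fun ω => Z ω i * Z ω j) μ :=
  have hmeas : Measurable fun x : ι → ℝ => x i * x j := by fun_prop
  hXZ.comp hmeas hmeas

variable [Fintype ι]

theorem dotProduct_sq_eq_sum_sum (x z : ι → ℝ) :
    (x ⬝ᵥ z) ^ 2 = ∑ i, ∑ j, (x i * x j) * (z i * z j) := by
  rw [sq, dotProduct, Finset.sum_mul_sum]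
  exact Finset.sum_congr rfl fun i _ => Finset.sum_congr rfl fun j _ => mul_mul_mul_comm ..

theorem integrable_sq_dotProduct_of_indepFun (hXZ : IndepFun X Z μ)
    (hX : ∀ i, MemLp (fun ω => X ω i) 2 μ) (hZ : ∀ i, MemLp (fun ω => Z ω i) 2 μ) :
    Integrable (fun ω => (X ω ⬝ᵥ Z ω) ^ 2) μ := by
  simp only [dotProduct_sq_eq_sum_sum]
  exact integrable_finsetSum _ fun i _ => integrable_finsetSum _ fun j _ =>
    (indepFun_mul_eval hXZ i j).integrable_mul ((hX i).integrable_mul (hX j))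
      ((hZ i).integrable_mul (hZ j))

theorem integral_sq_dotProduct_of_indepFun (hXZ : IndepFun X Z μ)
    (hX : ∀ i, MemLp (fun ω => X ω i) 2 μ) (hZ : ∀ i, MemLp (fun ω => Z ω i) 2 μ) :
    ∫ ω, (X ω ⬝ᵥ Z ω) ^ 2 ∂μ
      = ∑ i, ∑ j, (∫ ω, X ω i * X ω j ∂μ) * ∫ ω, Z ω i * Z ω j ∂μ := by
  have hint (i j : ι) : Integrable (fun ω => (X ω i * X ω j) * (Z ω i * Z ω j)) μ :=
    (indepFun_mul_eval hXZ i j).integrable_mul ((hX i).integrable_mul (hX j))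
      ((hZ i).integrable_mul (hZ j))
  simp only [dotProduct_sq_eq_sum_sum]
  rw [integral_finsetSum _ fun i _ => integrable_finsetSum _ fun j _ => hint i j]
  refine Finset.sum_congr rfl fun i _ => ?_
  rw [integral_finsetSum _ fun j _ => hint i j]
  refine Finset.sum_congr rfl fun j _ => ?_
  exact (indepFun_mul_eval hXZ i j).integral_fun_mul_eq_mul_integral
    ((hX i).integrable_mul (hX j)).aestronglyMeasurable
    ((hZ i).integrable_mul (hZ j)).aestronglyMeasurable

theorem integral_sq_dotProduct_of_indepFun_of_integral_mul [IsProbabilityMeasure μ]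
    [DecidableEq ι] {c : ι → ℝ} {v : ℝ} (hXZ : IndepFun X Z μ)
    (hX : ∀ i, MemLp (fun ω => X ω i) 2 μ) (hZ : ∀ i, MemLp (fun ω => Z ω i) 2 μ)
    (hXX : ∀ i j, ∫ ω, X ω i * X ω j ∂μ = c i * c j + if i = j then v else 0) :
    ∫ ω, (X ω ⬝ᵥ Z ω) ^ 2 ∂μ = ∫ ω, (c ⬝ᵥ Z ω) ^ 2 ∂μ + v * ∫ ω, Z ω ⬝ᵥ Z ω ∂μ := by
  have const_part : ∫ ω, (c ⬝ᵥ Z ω) ^ 2 ∂μ = ∑ i, ∑ j, c i * c j * ∫ ω, Z ω i * Z ω j ∂μ := by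
    simpa using integral_sq_dotProduct_of_indepFun (X := fun _ => c)
      (indepFun_const_left c Z) (fun i => memLp_const (c i)) hZ
  have noise_part : v * ∫ ω, Z ω ⬝ᵥ Z ω ∂μ
      = ∑ i, ∑ j, (if i = j then v else 0) * ∫ ω, Z ω i * Z ω j ∂μ := by
    have hint (i : ι) : Integrable (fun ω => Z ω i * Z ω i) μ := (hZ i).integrable_mul (hZ i)
    simp only [dotProduct, ite_mul, zero_mul, Finset.sum_ite_eq, Finset.mem_univ, if_true,
      integral_finsetSum _ fun i _ => hint i, Finset.mul_sum]
  rw [integral_sq_dotProduct_of_indepFun hXZ hX hZ, const_part, noise_part]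
  simp only [hXX, add_mul, Finset.sum_add_distrib]

end SecondMoment

namespace IsGaussianMatrix

variable {M : ℕ} {Ω : Type*} [MeasurableSpace Ω] {μ : Measure Ω} {v : ℝ≥0}
  {E : Ω → Matrix (Fin M) (Fin M) ℝ}

theorem aemeasurable (hE : IsGaussianMatrix μ v E) (i j : Fin M) :
    AEMeasurable (fun ω => E ω i j) μ :=
  (hE.hasLaw i j).aemeasurable

theorem memLp_two (hE : IsGaussianMatrix μ v E) (i j : Fin M) :
    MemLp (fun ω => E ω i j) 2 μ :=
  (hE.hasLaw i j).hasGaussianLaw.memLp_two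

theorem integral_eq_zero (hE : IsGaussianMatrix μ v E) (i j : Fin M) :
    ∫ ω, E ω i j ∂μ = 0 := by
  rw [(hE.hasLaw i j).integral_eq, integral_id_gaussianReal]

theorem covariance_eq (hE : IsGaussianMatrix μ v E) (i j k l : Fin M) :
    cov[fun ω => E ω i j, fun ω => E ω k l; μ] = if (i, j) = (k, l) then (v : ℝ) else 0 := by
  split_ifs with h
  · obtain ⟨rfl, rfl⟩ := Prod.mk.inj h
    rw [covariance_self (hE.aemeasurable i j), (hE.hasLaw i j).variance_eq,
      variance_id_gaussianReal]
  · exact (hE.indep.indepFun h).covariance_eq_zero (hE.memLp_two i j) (hE.memLp_two k l)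

theorem hasGaussianLaw_linearMap (hE : IsGaussianMatrix μ v E) {F : Type*} [NormedAddCommGroup F]
    [NormedSpace ℝ F] [MeasurableSpace F] [BorelSpace F]
    (L : Matrix (Fin M) (Fin M) ℝ →ₗ[ℝ] F) : HasGaussianLaw (fun ω => L (E ω)) μ :=
  (hE.indep.hasGaussianLaw fun p => (hE.hasLaw p.1 p.2).hasGaussianLaw).map_fun
    (LinearMap.toContinuousLinearMap (L ∘ₗ (LinearEquiv.curry ℝ ℝ (Fin M) (Fin M)).toLinearMap))

theorem iIndepFun_row (hE : IsGaussianMatrix μ v E) :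
    iIndepFun (fun i ω => E ω i) μ := by
  refine HasGaussianLaw.iIndepFun_of_covariance_eval (X := fun i j ω => E ω i j)
    (hE.hasGaussianLaw_linearMap (ofLinearEquiv ℝ).symm.toLinearMap) fun i j hij k l => ?_
  rw [hE.covariance_eq, if_neg (mt (congrArg Prod.fst) hij)]

theorem of_hasGaussianLaw
    (hlaw : HasGaussianLaw (fun ω (p : Fin M × Fin M) => E ω p.1 p.2) μ)
    (hmean : ∀ i j, ∫ ω, E ω i j ∂μ = 0)
    (hcov : ∀ i j k l, cov[fun ω => E ω i j, fun ω => E ω k l; μ]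
      = if (i, j) = (k, l) then (v : ℝ) else 0) :
    IsGaussianMatrix μ v E where
  hasLaw i j := by
    have hij : HasGaussianLaw (fun ω => E ω i j) μ := hlaw.eval (i, j)
    refine ⟨hij.aemeasurable, ?_⟩
    rw [hij.map_eq_gaussianReal, hmean, ← covariance_self hij.aemeasurable, hcov, if_pos rfl,
      Real.toNNReal_coe]
  indep := hlaw.iIndepFun_of_covariance_eq_zero fun p q hpq => by
    rw [hcov, if_neg hpq]

theorem covariance_mul_left [IsProbabilityMeasure μ] (hE : IsGaussianMatrix μ v E)
    (A B : Matrix (Fin M) (Fin M) ℝ) (i j k l : Fin M) :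
    cov[fun ω => (A * E ω) i j, fun ω => (B * E ω) k l; μ]
      = if j = l then (v : ℝ) * (A * Bᵀ) i k else 0 := by
  simp only [mul_apply]
  rw [covariance_fun_sum_fun_sum (fun a => (hE.memLp_two a j).const_mul _)
    fun b => (hE.memLp_two b l).const_mul _]
  simp only [covariance_const_mul_left, covariance_const_mul_right, hE.covariance_eq,
    Prod.mk.injEq, ite_and]
  split_ifs <;> simp [Finset.mul_sum, mul_comm, mul_left_comm, mul_assoc]

theorem mul_left_orthogonal [IsProbabilityMeasure μ] (hE : IsGaussianMatrix μ v E)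
    {U : Matrix (Fin M) (Fin M) ℝ} (hU : U ∈ orthogonalGroup (Fin M) ℝ) :
    IsGaussianMatrix μ v fun ω => U * E ω := by
  refine of_hasGaussianLaw (hE.hasGaussianLaw_linearMap
      ((LinearEquiv.curry ℝ ℝ (Fin M) (Fin M)).symm.toLinearMap ∘ₗ LinearMap.mulLeft ℝ U))
    (fun i j => ?_) fun i j k l => ?_
  · simp only [mul_apply]
    rw [integral_finsetSum _ fun a _ => ((hE.memLp_two a j).integrable one_le_two).const_mul _]
    simp only [integral_const_mul, hE.integral_eq_zero, mul_zero, Finset.sum_const_zero]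
  · rw [hE.covariance_mul_left, (mem_orthogonalGroup_iff (Fin M) ℝ).1 hU, one_apply]
    grind

theorem memLp_two_add [IsFiniteMeasure μ] (hE : IsGaussianMatrix μ v E)
    (C : Matrix (Fin M) (Fin M) ℝ) (i j : Fin M) : MemLp (fun ω => (C + E ω) i j) 2 μ :=
  (memLp_const (C i j)).add (hE.memLp_two i j)

theorem integral_add_mul_add [IsProbabilityMeasure μ] (hE : IsGaussianMatrix μ v E)
    (C : Matrix (Fin M) (Fin M) ℝ) (i j k l : Fin M) :
    ∫ ω, (C + E ω) i j * (C + E ω) k l ∂μ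
      = C i j * C k l + if (i, j) = (k, l) then (v : ℝ) else 0 := by
  have mean_add (i j : Fin M) : ∫ ω, (C + E ω) i j ∂μ = C i j := by
    simp only [Matrix.add_apply]
    rw [integral_add (integrable_const _) ((hE.memLp_two i j).integrable one_le_two),
      hE.integral_eq_zero, integral_const, probReal_univ, one_smul, add_zero]
  have cov_add : cov[fun ω => (C + E ω) i j, fun ω => (C + E ω) k l; μ]
      = if (i, j) = (k, l) then (v : ℝ) else 0 := by
    simp only [Matrix.add_apply]
    rw [covariance_const_add_left ((hE.memLp_two i j).integrable one_le_two),
      covariance_const_add_right ((hE.memLp_two k l).integrable one_le_two), hE.covariance_eq]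
  rw [← cov_add, covariance_eq_sub (hE.memLp_two_add C i j) (hE.memLp_two_add C k l), mean_add,
    mean_add, add_sub_cancel]
  rfl

theorem memLp_two_mul_add_apply [IsProbabilityMeasure μ] (hE : IsGaussianMatrix μ v E)
    (P C : Matrix (Fin M) (Fin M) ℝ) (i j : Fin M) :
    MemLp (fun ω => (P * (C + E ω)) i j) 2 μ := by
  simp only [mul_apply]
  exact memLp_finsetSum _ fun a _ => (hE.memLp_two_add C a j).const_mul _

theorem integrable_hsNormSq_mul [IsProbabilityMeasure μ] (hE : IsGaussianMatrix μ v E)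
    (P C : Matrix (Fin M) (Fin M) ℝ) : Integrable (fun ω => hsNormSq (P * (C + E ω))) μ :=
  integrable_finsetSum _ fun i _ => integrable_finsetSum _ fun j _ =>
    (hE.memLp_two_mul_add_apply P C i j).integrable_sq

theorem integral_mul_add_apply_sq [IsProbabilityMeasure μ] (hE : IsGaussianMatrix μ v E)
    (P C : Matrix (Fin M) (Fin M) ℝ) (i j : Fin M) :
    ∫ ω, (P * (C + E ω)) i j ^ 2 ∂μ = (P * C) i j ^ 2 + v * (P i ⬝ᵥ P i) := by
  have h := integral_sq_dotProduct_of_indepFun_of_integral_mul (μ := μ) (v := v)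
    (X := fun ω a => (C + E ω) a j) (Z := fun _ => P i) (c := fun a => C a j)
    (indepFun_const_right _ _) (fun a => hE.memLp_two_add C a j) (fun a => memLp_const _)
    fun a b => by simp only [hE.integral_add_mul_add, Prod.mk.injEq, and_true]
  simpa only [dotProduct_comm _ (P i), integral_const, probReal_univ, one_smul, mul_apply'] using! h

theorem integral_hsNormSq_mul [IsProbabilityMeasure μ] (hE : IsGaussianMatrix μ v E)
    (P C : Matrix (Fin M) (Fin M) ℝ) :
    ∫ ω, hsNormSq (P * (C + E ω)) ∂μ = hsNormSq (P * C) + v * M * hsNormSq P := by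
  have hint (i j : Fin M) := (hE.memLp_two_mul_add_apply P C i j).integrable_sq
  calc
    _ = ∑ i, ∑ j, ((P * C) i j ^ 2 + v * (P i ⬝ᵥ P i)) := by
      simp only [hsNormSq, ← hE.integral_mul_add_apply_sq,
        integral_finsetSum _ fun i _ => integrable_finsetSum _ fun j _ => hint i j,
        integral_finsetSum _ fun j _ => hint _ j]
    _ = _ := by
      rw [hsNormSq_eq_sum_dotProduct_self P, hsNormSq]
      simp only [Finset.sum_add_distrib, Finset.sum_const, Finset.card_univ, Fintype.card_fin,
        nsmul_eq_mul, ← Finset.mul_sum]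
      ring

theorem integral_hsNormSq_populationProj_mul [NeZero M] [IsProbabilityMeasure μ]
    (hE : IsGaussianMatrix μ v E) (C : Matrix (Fin M) (Fin M) ℝ) :
    ∫ ω, hsNormSq (populationProj μ 1 (fun ω' => C + E ω') * (C + E ω)) ∂μ
      = ‖C‖ ^ 2 + v * M := by
  have hcont : Continuous fun P => ∫ ω, hsNormSq (P * (C + E ω)) ∂μ := by
    simp only [hE.integral_hsNormSq_mul]
    unfold hsNormSq
    fun_prop
  obtain ⟨hmem, hmax⟩ := argmaxProj_spec (NeZero.one_le (n := M)) hcont.continuousOn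
  have value {P : Matrix (Fin M) (Fin M) ℝ} (hP : P ∈ orthProj M 1) :
      ∫ ω, hsNormSq (P * (C + E ω)) ∂μ = hsNormSq (P * C) + v * M := by
    rw [hE.integral_hsNormSq_mul, hsNormSq_of_mem_orthProj hP, Nat.cast_one, mul_one]
  rw [populationProj, value hmem]
  congr 1
  refine hsNormSq_mul_eq_of_isMaxOn hmem fun P hP => ?_
  have := hmax hP
  simp only [Set.mem_ofPred_eq, value hP, value hmem] at this ⊢
  linarith

theorem aestronglyMeasurable_add [IsFiniteMeasure μ] (hE : IsGaussianMatrix μ v E)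
    (C : Matrix (Fin M) (Fin M) ℝ) : AEStronglyMeasurable (fun ω => C + E ω) μ :=
  have hmeas : AEMeasurable (fun ω i j => (C + E ω) i j) μ :=
    aemeasurable_pi_lambda _ fun i => aemeasurable_pi_lambda _ fun j =>
      (hE.memLp_two_add C i j).aemeasurable
  hmeas.aestronglyMeasurable

theorem integrable_norm_sq_add [NeZero M] [IsProbabilityMeasure μ] (hE : IsGaussianMatrix μ v E)
    (C : Matrix (Fin M) (Fin M) ℝ) : Integrable (fun ω => ‖C + E ω‖ ^ 2) μ := by
  refine (hE.integrable_hsNormSq_mul 1 C).mono' ((hE.aestronglyMeasurable_add C).norm.pow 2)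
    (.of_forall fun ω => ?_)
  rw [Real.norm_of_nonneg (sq_nonneg _), one_mul]
  exact norm_sq_le_hsNormSq _

theorem delta_eq [NeZero M] [IsProbabilityMeasure μ] (hE : IsGaussianMatrix μ v E)
    (C : Matrix (Fin M) (Fin M) ℝ) :
    delta μ E C 1 = ∫ ω, ‖C + E ω‖ ^ 2 ∂μ - v * M - ‖C‖ ^ 2 := by
  rw [delta, hE.integral_hsNormSq_populationProj_mul]
  simp only [hsNormSq_empiricalProj_mul]
  ring

theorem iIndepFun_row_add (hE : IsGaussianMatrix μ v E)
    (C : Matrix (Fin M) (Fin M) ℝ) : iIndepFun (fun i ω => (C + E ω) i) μ :=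
  hE.iIndepFun_row.comp (fun i x => C i + x) fun i => by fun_prop

theorem ae_row_add_ne_zero [NeZero M] (hE : IsGaussianMatrix μ v E) (hv : v ≠ 0)
    (C : Matrix (Fin M) (Fin M) ℝ) (k : Fin M) : ∀ᵐ ω ∂μ, (C + E ω) k ≠ 0 := by
  have := nullSingletonClass_gaussianReal (μ := 0) hv
  have hne : ∀ᵐ ω ∂μ, E ω k 0 ≠ -C k 0 :=
    ((hE.hasLaw k 0).ae_iff (p := fun x => x ≠ -C k 0)
      (measurableSet_setOfPred.1 (measurableSet_singleton (-C k 0)).compl)).2 (Measure.ae_ne _ _)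
  filter_upwards [hne] with ω hω h0
  exact hω (eq_neg_of_add_eq_zero_right (congrFun h0 0))

theorem integral_row_add_dotProduct_self [IsProbabilityMeasure μ] (hE : IsGaussianMatrix μ v E)
    (C : Matrix (Fin M) (Fin M) ℝ) (k : Fin M) :
    ∫ ω, (C + E ω) k ⬝ᵥ (C + E ω) k ∂μ = C k ⬝ᵥ C k + v * M := by
  have hint (j : Fin M) : Integrable (fun ω => (C + E ω) k j * (C + E ω) k j) μ :=
    (hE.memLp_two_add C k j).integrable_mul (hE.memLp_two_add C k j)
  simp only [dotProduct, integral_finsetSum _ fun j _ => hint j, hE.integral_add_mul_add, if_true,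
    Finset.sum_add_distrib, Finset.sum_const, Finset.card_univ, Fintype.card_fin, nsmul_eq_mul,
    mul_comm]

theorem aemeasurable_row_add [IsFiniteMeasure μ] (hE : IsGaussianMatrix μ v E)
    (C : Matrix (Fin M) (Fin M) ℝ) (k : Fin M) : AEMeasurable (fun ω => (C + E ω) k) μ :=
  aemeasurable_pi_lambda _ fun j => (hE.memLp_two_add C k j).aemeasurable

theorem memLp_two_direction_row_add [IsFiniteMeasure μ] (hE : IsGaussianMatrix μ v E)
    (C : Matrix (Fin M) (Fin M) ℝ) (k j : Fin M) :
    MemLp (fun ω => direction ((C + E ω) k) j) 2 μ := by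
  refine MemLp.of_bound ?_ 1 (.of_forall fun ω => abs_direction_apply_le_one _ j)
  exact ((measurable_pi_apply j).comp (measurable_direction)).comp_aemeasurable
    (hE.aemeasurable_row_add C k) |>.aestronglyMeasurable

theorem le_integral_sq_dotProduct_direction [NeZero M] [IsProbabilityMeasure μ]
    (hE : IsGaussianMatrix μ v E) (hv : v ≠ 0) (C : Matrix (Fin M) (Fin M) ℝ) {i k : Fin M}
    (hik : i ≠ k) : v ≤ ∫ ω, ((C + E ω) i ⬝ᵥ direction ((C + E ω) k)) ^ 2 ∂μ := by
  have hindep : IndepFun (fun ω => (C + E ω) i) (fun ω => direction ((C + E ω) k)) μ :=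
    ((hE.iIndepFun_row_add C).indepFun hik).comp measurable_id measurable_direction
  have unit : ∫ ω, direction ((C + E ω) k) ⬝ᵥ direction ((C + E ω) k) ∂μ = 1 := by
    have hae : (fun ω => direction ((C + E ω) k) ⬝ᵥ direction ((C + E ω) k)) =ᵐ[μ] fun _ => 1 := by
      filter_upwards [hE.ae_row_add_ne_zero hv C k] with ω hω
      exact direction_dotProduct_self_of_ne_zero hω
    rw [integral_congr_ae hae, integral_const, probReal_univ, one_smul]
  rw [integral_sq_dotProduct_of_indepFun_of_integral_mul (c := C i) (v := v) hindep
    (hE.memLp_two_add C i) (hE.memLp_two_direction_row_add C k)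
    fun a b => by simp only [hE.integral_add_mul_add, Prod.mk.injEq, true_and], unit, mul_one]
  exact le_add_of_nonneg_left (integral_nonneg fun ω => sq_nonneg _)

theorem row_dotProduct_self_add_le_integral_norm_sq [NeZero M] [IsProbabilityMeasure μ]
    (hE : IsGaussianMatrix μ v E) (hv : v ≠ 0) (C : Matrix (Fin M) (Fin M) ℝ) (k : Fin M) :
    C k ⬝ᵥ C k + v * M + v * (M - 1) ≤ ∫ ω, ‖C + E ω‖ ^ 2 ∂μ := by
  have hrow : Integrable (fun ω => (C + E ω) k ⬝ᵥ (C + E ω) k) μ :=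
    integrable_finsetSum _ fun j _ =>
      (hE.memLp_two_add C k j).integrable_mul (hE.memLp_two_add C k j)
  have hcross (i : Fin M) (hi : i ∈ Finset.univ.erase k) :
      Integrable (fun ω => ((C + E ω) i ⬝ᵥ direction ((C + E ω) k)) ^ 2) μ :=
    integrable_sq_dotProduct_of_indepFun
      (((hE.iIndepFun_row_add C).indepFun (Finset.ne_of_mem_erase hi)).comp measurable_id
        measurable_direction)
      (hE.memLp_two_add C i) (hE.memLp_two_direction_row_add C k)
  calc
    _ = C k ⬝ᵥ C k + v * M + ∑ _i ∈ Finset.univ.erase k, (v : ℝ) := by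
      rw [Finset.sum_const, Finset.card_erase_of_mem (Finset.mem_univ k), Finset.card_univ,
        Fintype.card_fin, nsmul_eq_mul, Nat.cast_pred (NeZero.pos M), mul_comm (v : ℝ) (M - 1)]
    _ ≤ C k ⬝ᵥ C k + v * M + ∑ i ∈ Finset.univ.erase k,
        ∫ ω, ((C + E ω) i ⬝ᵥ direction ((C + E ω) k)) ^ 2 ∂μ := by
      gcongr with i hi
      exact hE.le_integral_sq_dotProduct_direction hv C (Finset.ne_of_mem_erase hi)
    _ = ∫ ω, ((C + E ω) k ⬝ᵥ (C + E ω) k + ∑ i ∈ Finset.univ.erase k,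
        ((C + E ω) i ⬝ᵥ direction ((C + E ω) k)) ^ 2) ∂μ := by
      rw [integral_add hrow (integrable_finsetSum _ hcross), integral_finsetSum _ hcross,
        hE.integral_row_add_dotProduct_self]
    _ ≤ ∫ ω, ‖C + E ω‖ ^ 2 ∂μ :=
      integral_mono (hrow.add (integrable_finsetSum _ hcross)) (hE.integrable_norm_sq_add C)
        fun ω => dotProduct_self_add_sum_sq_dotProduct_direction_le (C + E ω) k

theorem norm_sq_add_le_integral_norm_sq [NeZero M] [IsProbabilityMeasure μ]
    (hE : IsGaussianMatrix μ v E) (hv : v ≠ 0) (C : Matrix (Fin M) (Fin M) ℝ) :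
    ‖C‖ ^ 2 + v * M + v * (M - 1) ≤ ∫ ω, ‖C + E ω‖ ^ 2 ∂μ := by
  obtain ⟨u, hu, huC⟩ := exists_vecMul_dotProduct_self_eq C
  obtain ⟨U, hU, hU0⟩ := exists_mem_orthogonalGroup_row_eq 0 hu
  have row_eq : (U * C) 0 = u ᵥ* C := by rw [mul_apply_eq_vecMul, hU0]
  have norm_eq (ω : Ω) : ‖U * C + U * E ω‖ = ‖C + E ω‖ := by
    rw [← mul_add, CStarRing.norm_mem_unitary_mul _ hU]
  simpa only [row_eq, huC, norm_eq] using
    (hE.mul_left_orthogonal hU).row_dotProduct_self_add_le_integral_norm_sq hv (U * C) 0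

theorem mul_le_delta [NeZero M] [IsProbabilityMeasure μ] (hE : IsGaussianMatrix μ v E)
    (hv : v ≠ 0) (C : Matrix (Fin M) (Fin M) ℝ) : v * (M - 1) ≤ delta μ E C 1 := by
  rw [hE.delta_eq]
  linarith [hE.norm_sq_add_le_integral_norm_sq hv C]

end IsGaussianMatrix

section ExponentialMoment

theorem mgf_sq_gaussianReal {w : ℝ≥0} {t : ℝ} (ht : 2 * w * t < 1) :
    mgf (fun x => x ^ 2) (gaussianReal 0 w) t = (√(1 - 2 * w * t))⁻¹ := by
  rcases eq_or_ne w 0 with rfl | hw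
  · simp [mgf]
  have : (0 : ℝ) < w := by exact_mod_cast pos_iff_ne_zero.2 hw
  have combine (x : ℝ) : gaussianPDFReal 0 w x * Real.exp (t * x ^ 2)
      = (√(2 * Real.pi * w))⁻¹ * Real.exp (-((1 - 2 * w * t) / (2 * w)) * x ^ 2) := by
    rw [gaussianPDFReal, mul_assoc, ← Real.exp_add]
    congr 2
    field_simp
    ring
  rw [mgf, integral_gaussianReal_eq_integral_smul hw]
  simp only [smul_eq_mul, combine]
  rw [integral_const_mul, integral_gaussian, ← Real.sqrt_inv, ← Real.sqrt_inv,
    ← Real.sqrt_mul (by positivity)]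
  have : 1 - 2 * w * t ≠ 0 := (sub_pos.2 ht).ne'
  congr 1
  field_simp

theorem integral_le_of_lintegral_exp_le {Ω : Type*} [MeasurableSpace Ω] {μ : Measure Ω}
    [IsProbabilityMeasure μ] {X : Ω → ℝ} {K : ℝ} (hX : Integrable X μ)
    (hexp : ∫⁻ ω, ENNReal.ofReal (Real.exp (X ω)) ∂μ ≤ ENNReal.ofReal (Real.exp K)) :
    ∫ ω, X ω ∂μ ≤ K := by
  have hmeas : AEStronglyMeasurable (fun ω => Real.exp (X ω)) μ :=
    Real.continuous_exp.comp_aestronglyMeasurable hX.aestronglyMeasurable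
  have hnonneg : 0 ≤ᵐ[μ] fun ω => Real.exp (X ω) := .of_forall fun ω => (Real.exp_pos _).le
  have hint : Integrable (fun ω => Real.exp (X ω)) μ :=
    (lintegral_ofReal_ne_top_iff_integrable hmeas hnonneg).1
      (hexp.trans_lt ENNReal.ofReal_lt_top).ne
  rw [← Real.exp_le_exp]
  calc
    Real.exp (∫ ω, X ω ∂μ) ≤ ∫ ω, Real.exp (X ω) ∂μ :=
      convexOn_exp.map_integral_le Real.continuous_exp.continuousOn isClosed_univ
        (.of_forall fun _ => Set.mem_univ _) hX hint
    _ ≤ Real.exp K := by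
      rw [integral_eq_lintegral_of_nonneg_ae hnonneg hmeas]
      exact ENNReal.toReal_le_of_le_ofReal (Real.exp_pos _).le hexp

end ExponentialMoment

section VolumeComparison

variable {V F : Type*} [NormedAddCommGroup V] [NormedSpace ℝ V] [FiniteDimensional ℝ V]
  [Nontrivial V] [NormedAddCommGroup F] [NormedSpace ℝ F]

theorem exists_forall_mem_ball_opNorm_div_two_le (T : V →L[ℝ] F) :
    ∃ w, ‖w‖ = 1 ∧ ∀ z ∈ Metric.ball w (1 / 2), ‖T‖ / 2 ≤ ‖T z‖ := by
  obtain ⟨w, hw, hTw⟩ := exists_norm_eq_one_norm_apply_eq T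
  refine ⟨w, hw, fun z hz => ?_⟩
  rw [mem_ball_iff_norm'] at hz
  have far : ‖T w‖ - ‖T z‖ ≤ ‖T‖ * (1 / 2) :=
    calc
      _ ≤ ‖T (w - z)‖ := by rw [map_sub]; exact norm_sub_norm_le _ _
      _ ≤ ‖T‖ * ‖w - z‖ := T.le_opNorm _
      _ ≤ ‖T‖ * (1 / 2) := by gcongr
  linarith

theorem mul_addHaar_ball_le_setLIntegral [MeasurableSpace V] [BorelSpace V] (ν : Measure V)
    [ν.IsAddHaarMeasure] (T : V →L[ℝ] F) {φ : ℝ≥0 → ENNReal} (hφ : Monotone φ) :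
    φ (‖T‖₊ / 2) * ν (Metric.ball 0 (1 / 2)) ≤ ∫⁻ z in Metric.ball 0 (3 / 2), φ ‖T z‖₊ ∂ν := by
  obtain ⟨w, hw, hTw⟩ := exists_forall_mem_ball_opNorm_div_two_le T
  rw [← Measure.addHaar_ball_center ν w, ← setLIntegral_const]
  refine (setLIntegral_mono' measurableSet_ball fun z hz => hφ (hTw z hz)).trans
    (lintegral_mono_set (Metric.ball_subset_ball' ?_))
  rw [dist_zero_right, hw]
  norm_num

theorem lintegral_comp_nnnorm_div_two_le {Ω : Type*} [MeasurableSpace Ω] {μ : Measure Ω}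
    [SFinite μ] {T : Ω → V →L[ℝ] F} (hT : AEStronglyMeasurable T μ) {φ : ℝ≥0 → ENNReal}
    (hφ : Monotone φ) {B : ENNReal}
    (hB : ∀ z ∈ Metric.ball (0 : V) (3 / 2), ∫⁻ ω, φ ‖T ω z‖₊ ∂μ ≤ B) :
    ∫⁻ ω, φ (‖T ω‖₊ / 2) ∂μ ≤ 3 ^ Module.finrank ℝ V * B := by
  borelize V
  have : ProperSpace V := FiniteDimensional.proper_real V
  set ν : Measure V := Measure.addHaar
  set small := ν (Metric.ball 0 (1 / 2))
  have small_ne_zero : small ≠ 0 := (Metric.measure_ball_pos ν 0 (by norm_num)).ne'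
  have small_ne_top : small ≠ ⊤ := measure_ball_lt_top.ne
  have large_eq : ν (Metric.ball 0 (3 / 2)) = 3 ^ Module.finrank ℝ V * small := by
    rw [show (3 / 2 : ℝ) = 3 * (1 / 2) by norm_num, Measure.addHaar_ball_mul ν 0 (by norm_num),
      ENNReal.ofReal_pow (by norm_num), ENNReal.ofReal_ofNat]
  have hmeas : AEMeasurable (Function.uncurry fun ω z => φ ‖T ω z‖₊)
      (μ.prod (ν.restrict (Metric.ball 0 (3 / 2)))) := by
    have happ : AEStronglyMeasurable (fun q : Ω × V => T q.1 q.2)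
        (μ.prod (ν.restrict (Metric.ball 0 (3 / 2)))) :=
      isBoundedBilinearMap_apply.continuous.comp_aestronglyMeasurable
        (hT.comp_fst.prodMk measurable_snd.aestronglyMeasurable)
    exact hφ.measurable.comp_aemeasurable happ.nnnorm.aemeasurable
  refine (ENNReal.mul_le_mul_iff_left small_ne_zero small_ne_top).1 ?_
  calc
    _ = ∫⁻ ω, φ (‖T ω‖₊ / 2) * small ∂μ := (lintegral_mul_const' _ _ small_ne_top).symm
    _ ≤ ∫⁻ ω, ∫⁻ z in Metric.ball 0 (3 / 2), φ ‖T ω z‖₊ ∂ν ∂μ :=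
      lintegral_mono fun ω => mul_addHaar_ball_le_setLIntegral ν (T ω) hφ
    _ = ∫⁻ z in Metric.ball 0 (3 / 2), ∫⁻ ω, φ ‖T ω z‖₊ ∂μ ∂ν := lintegral_lintegral_swap hmeas
    _ ≤ ∫⁻ _z in Metric.ball (0 : V) (3 / 2), B ∂ν := setLIntegral_mono' measurableSet_ball hB
    _ = _ := by rw [setLIntegral_const, large_eq, mul_left_comm, mul_assoc]

end VolumeComparison

namespace IsGaussianMatrix

variable {M : ℕ} {Ω : Type*} [MeasurableSpace Ω] {μ : Measure Ω} [IsProbabilityMeasure μ] {v : ℝ≥0}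
  {E : Ω → Matrix (Fin M) (Fin M) ℝ}

theorem hasLaw_row_dotProduct (hE : IsGaussianMatrix μ v E) (i : Fin M) (z : Fin M → ℝ) :
    HasLaw (fun ω => E ω i ⬝ᵥ z) (gaussianReal 0 (v * (z ⬝ᵥ z).toNNReal)) μ := by
  have hlaw : HasGaussianLaw (fun ω => E ω i ⬝ᵥ z) μ :=
    hE.hasGaussianLaw_linearMap (LinearMap.proj i ∘ₗ (mulVecBilin ℝ ℝ).flip z)
  have mean : ∫ ω, E ω i ⬝ᵥ z ∂μ = 0 := by
    simp only [dotProduct]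
    rw [integral_finsetSum _ fun j _ => ((hE.memLp_two i j).integrable one_le_two).mul_const _]
    simp only [integral_mul_const, hE.integral_eq_zero, zero_mul, Finset.sum_const_zero]
  have second_moment : ∫ ω, (E ω i ⬝ᵥ z) ^ 2 ∂μ = v * (z ⬝ᵥ z) := by
    simpa using integral_sq_dotProduct_of_indepFun_of_integral_mul (c := 0) (v := v)
      (indepFun_const_right (fun ω => E ω i) z) (hE.memLp_two i) (fun j => memLp_const (z j))
      fun a b => by simpa using hE.integral_add_mul_add 0 i a i b
  refine ⟨hlaw.aemeasurable, ?_⟩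
  rw [hlaw.map_eq_gaussianReal, mean, variance_of_integral_eq_zero hlaw.aemeasurable mean,
    second_moment, Real.toNNReal_mul v.coe_nonneg, Real.toNNReal_coe]

theorem mgf_mulVec_dotProduct_self (hE : IsGaussianMatrix μ v E) {z : Fin M → ℝ} {t : ℝ}
    (ht : 2 * (v * (z ⬝ᵥ z)) * t < 1) :
    mgf (fun ω => (E ω *ᵥ z) ⬝ᵥ (E ω *ᵥ z)) μ t = (√(1 - 2 * (v * (z ⬝ᵥ z)) * t))⁻¹ ^ M := by
  have hz : 0 ≤ z ⬝ᵥ z := by simpa using dotProduct_star_self_nonneg z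
  have hindep : iIndepFun (fun i ω => (E ω i ⬝ᵥ z) ^ 2) μ :=
    hE.iIndepFun_row.comp (fun _ x => (x ⬝ᵥ z) ^ 2) fun _ => by unfold dotProduct; fun_prop
  have sum_eq : (fun ω => (E ω *ᵥ z) ⬝ᵥ (E ω *ᵥ z)) = ∑ i, fun ω => (E ω i ⬝ᵥ z) ^ 2 := by
    ext ω
    rw [Finset.sum_apply]
    exact Finset.sum_congr rfl fun i _ => (sq _).symm
  have mgf_row (i : Fin M) : mgf (fun ω => (E ω i ⬝ᵥ z) ^ 2) μ t
      = (√(1 - 2 * (v * (z ⬝ᵥ z)) * t))⁻¹ := by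
    have hlaw := hE.hasLaw_row_dotProduct i z
    have := mgf_sq_gaussianReal (w := v * (z ⬝ᵥ z).toNNReal) (t := t)
    rw [NNReal.coe_mul, Real.coe_toNNReal _ hz] at this
    rw [← this ht, ← hlaw.map_eq, mgf_map hlaw.aemeasurable (by fun_prop)]
    rfl
  rw [sum_eq, hindep.mgf_sum₀ fun i => (hE.hasLaw_row_dotProduct i z).aemeasurable.pow_const 2]
  simp only [mgf_row, Finset.prod_const, Finset.card_univ, Fintype.card_fin]

theorem lintegral_exp_mulVec_dotProduct_self_le (hE : IsGaussianMatrix μ v E) {z : Fin M → ℝ}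
    {t : ℝ} (ht : 2 * (v * (z ⬝ᵥ z)) * t ≤ 3 / 4) :
    ∫⁻ ω, ENNReal.ofReal (Real.exp (t * ((E ω *ᵥ z) ⬝ᵥ (E ω *ᵥ z)))) ∂μ ≤ 2 ^ M := by
  have hmgf := hE.mgf_mulVec_dotProduct_self (ht.trans_lt (by norm_num))
  have half_le : 1 / 2 ≤ √(1 - 2 * (v * (z ⬝ᵥ z)) * t) := Real.le_sqrt_of_sq_le (by linarith)
  have : 0 < √(1 - 2 * (v * (z ⬝ᵥ z)) * t) := half_le.trans_lt' (by norm_num)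
  have hint : Integrable (fun ω => Real.exp (t * ((E ω *ᵥ z) ⬝ᵥ (E ω *ᵥ z)))) μ :=
    .of_integral_ne_zero (hmgf.trans_ne (by positivity))
  rw [← ofReal_integral_eq_lintegral_ofReal hint (.of_forall fun _ => (Real.exp_pos _).le),
    ← mgf, hmgf, ← ENNReal.ofReal_ofNat 2, ← ENNReal.ofReal_pow zero_le_two]
  gcongr
  exact inv_le_of_inv_le₀ zero_lt_two (by rwa [← one_div])

theorem aestronglyMeasurable_toEuclideanCLM (hE : IsGaussianMatrix μ v E) :
    AEStronglyMeasurable (fun ω => toEuclideanCLM (𝕜 := ℝ) (E ω)) μ := by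
  have hmeas : AEStronglyMeasurable E μ := by simpa using hE.aestronglyMeasurable_add 0
  exact (LinearMap.continuous_of_finiteDimensional
    (toEuclideanCLM (n := Fin M) (𝕜 := ℝ)).toAlgEquiv.toLinearMap).comp_aestronglyMeasurable hmeas

theorem lintegral_exp_norm_div_two_sq_le [NeZero M] (hE : IsGaussianMatrix μ v E) {t : ℝ}
    (ht₀ : 0 ≤ t) (ht : 6 * v * t ≤ 1) :
    ∫⁻ ω, ENNReal.ofReal (Real.exp (t * (‖E ω‖ / 2) ^ 2)) ∂μ ≤ 3 ^ M * 2 ^ M := by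
  set φ : ℝ≥0 → ENNReal := fun s => ENNReal.ofReal (Real.exp (t * (s : ℝ) ^ 2))
  have hφ : Monotone φ := fun a b hab => by
    simp only [φ]
    gcongr
  have hball (z : EuclideanSpace ℝ (Fin M)) (hz : z ∈ Metric.ball 0 (3 / 2)) :
      ∫⁻ ω, φ ‖toEuclideanCLM (𝕜 := ℝ) (E ω) z‖₊ ∂μ ≤ 2 ^ M := by
    have hz' : z.ofLp ⬝ᵥ z.ofLp ≤ (3 / 2) ^ 2 := by
      rw [← norm_toLp_sq]
      exact pow_le_pow_left₀ (norm_nonneg _) (mem_ball_zero_iff.1 hz).le 2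
    have key := hE.lintegral_exp_mulVec_dotProduct_self_le (z := z.ofLp) (t := t) <|
      calc
        _ ≤ 2 * (v * (3 / 2) ^ 2) * t := by gcongr
        _ ≤ 3 / 4 := by linarith
    simp only [← norm_toLp_sq] at key
    exact key
  have hcomp := lintegral_comp_nnnorm_div_two_le hE.aestronglyMeasurable_toEuclideanCLM hφ hball
  rwa [finrank_euclideanSpace_fin] at hcomp

theorem integral_norm_sq_le [NeZero M] (hE : IsGaussianMatrix μ v E) (hv : v ≠ 0) :
    ∫ ω, ‖E ω‖ ^ 2 ∂μ ≤ 48 * (v * M) := by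
  have : (0 : ℝ) < v := by exact_mod_cast pos_iff_ne_zero.2 hv
  have six_le_exp_two : 6 ≤ Real.exp 2 := by
    rw [show (2 : ℝ) = 1 + 1 by norm_num, Real.exp_add]
    nlinarith [Real.exp_one_gt_d9]
  have hint : Integrable (fun ω => ‖E ω‖ ^ 2) μ := by simpa using hE.integrable_norm_sq_add 0
  have rescale (ω : Ω) : (6 * v : ℝ)⁻¹ * (‖E ω‖ / 2) ^ 2 = (24 * v : ℝ)⁻¹ * ‖E ω‖ ^ 2 := by
    ring
  have exp_moment : ∫⁻ ω, ENNReal.ofReal (Real.exp ((24 * v : ℝ)⁻¹ * ‖E ω‖ ^ 2)) ∂μ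
      ≤ ENNReal.ofReal (Real.exp (2 * M)) :=
    calc
      _ ≤ (3 ^ M * 2 ^ M : ENNReal) := by
        simpa only [rescale] using
          hE.lintegral_exp_norm_div_two_sq_le (t := (6 * v)⁻¹) (by positivity)
            (mul_inv_cancel₀ (by positivity)).le
      _ = ENNReal.ofReal (6 ^ M) := by
        rw [← mul_pow, ENNReal.ofReal_pow (by norm_num), ENNReal.ofReal_ofNat]
        norm_num
      _ ≤ ENNReal.ofReal (Real.exp (2 * M)) := by
        rw [mul_comm, Real.exp_nat_mul]
        gcongr
  have h := integral_le_of_lintegral_exp_le (hint.const_mul _) exp_moment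
  rw [integral_const_mul, inv_mul_le_iff₀ (by positivity)] at h
  linarith

theorem delta_zero_le [NeZero M] (hE : IsGaussianMatrix μ v E) (hv : v ≠ 0) :
    delta μ E 0 1 ≤ 48 * (v * M) := by
  have h := hE.integral_norm_sq_le hv
  have : (0 : ℝ) ≤ v * M := by positivity
  rw [hE.delta_eq]
  simp only [zero_add, norm_zero]
  linarith

end IsGaussianMatrix

end RankProjection

theorem mainTheorem2 :
    ∃ c : ℝ, 0 < c ∧ ∃ M₀ : ℕ, ∀ M : ℕ, M₀ ≤ M → ∀ v : ℝ≥0, 0 < v →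
      ∀ (Ω : Type*) [MeasurableSpace Ω] (μ : Measure Ω) [IsProbabilityMeasure μ]
        (E : Ω → Matrix (Fin M) (Fin M) ℝ), RankProjection.IsGaussianMatrix μ v E →
        (∀ C : Matrix (Fin M) (Fin M) ℝ, Integrable (fun ω =>
          RankProjection.hsNormSq (RankProjection.empiricalProj 1 (C + E ω) * (C + E ω))) μ) ∧
        (∀ C P : Matrix (Fin M) (Fin M) ℝ, Integrable (fun ω =>
          RankProjection.hsNormSq (P * (C + E ω))) μ) ∧
        BddBelow (Set.range fun C : Matrix (Fin M) (Fin M) ℝ => RankProjection.delta μ E C 1) ∧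
        c * RankProjection.delta μ E 0 1
          ≤ ⨅ C : Matrix (Fin M) (Fin M) ℝ, RankProjection.delta μ E C 1 ∧
        c * ((v : ℝ) * M)
          ≤ ⨅ C : Matrix (Fin M) (Fin M) ℝ, RankProjection.delta μ E C 1 ∧
        ∀ C : Matrix (Fin M) (Fin M) ℝ,
          c * ((v : ℝ) * M)
            ≤ (∫ ω, RankProjection.topSingularValue (C + E ω) ^ 2 ∂μ)
              - (v : ℝ) * M - RankProjection.topSingularValue C ^ 2 := by
  refine ⟨1 / 96, by norm_num, 2, fun M hM v hv Ω _ μ _ E hE => ?_⟩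
  have : NeZero M := ⟨by omega⟩
  have hvM : (0 : ℝ) ≤ v * M := by positivity
  have lower (C : Matrix (Fin M) (Fin M) ℝ) : v * M / 2 ≤ RankProjection.delta μ E C 1 := by
    have hM' : (2 : ℝ) ≤ M := by exact_mod_cast hM
    have := hE.mul_le_delta hv.ne' C
    nlinarith [v.2]
  have lower_iInf : v * M / 2 ≤ ⨅ C, RankProjection.delta μ E C 1 := le_ciInf lower
  have upper := hE.delta_zero_le hv.ne'
  refine ⟨fun C => ?_, fun C P => hE.integrable_hsNormSq_mul P C,
    ⟨v * M / 2, Set.forall_mem_range.2 lower⟩, by linarith, by linarith, fun C => ?_⟩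
  · simpa only [RankProjection.hsNormSq_empiricalProj_mul] using hE.integrable_norm_sq_add C
  · simp only [RankProjection.topSingularValue_eq_norm, ← hE.delta_eq]
    linarith [lower C]
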